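/- Let $K$ be a finite nonabelian group with trivial center, and for $n\ge 0$ let $G=K^n$. Let $\widehat G$ be the set of irreducible unitary representations of $G$ up to isomorphism, let $d_\rho$ and $\chi_\rho$ denote the dimension and the character of $\rho$, and recall that the Plancherel measure on $\widehat G$ gives $\rho$ the probability $d_\rho^2/|G|$. For a subgroup $H\le G$ put $$X_H(\rho)=\frac{\langle \operatorname{Res}_H\chi_\rho,1\rangle_H}{d_\rho},\qquad \langle\phi,\psi\rangle_H=\frac1{|H|}\sum_{h\in H}\phi(h)\overline{\psi(h)},$$ so that $X_H(\rho)=0$ if and only if the restriction of $\rho$ to $H$ has no trivial component. (1) Let $n,t\ge 0$ be integers and $\alpha$ a real number with $2|K|^t\le\alpha\sqrt n$. Let $h^{(1)},\dots,h^{(t)}$ be independent uniformly random elements of $G$, let $H$ be the subgroup that they generate, and let $\rho$ be drawn from the Plancherel measure on $\widehat G$, independently of the $h^{(m)}$. Then $$\Pr_{\rho,\{h^{(m)}\}}[X_H(\rho)=0]\le\frac{2\alpha}{\sqrt n}+\left(2^{-1/\alpha}|K|^{\alpha}\right)^{\sqrt n}.$$ (2) Let $\log$ be the logarithm to base $2$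 or to base $e$ (the statement holds for each of the two choices, the same base being used throughout). If $t\ge1$ and $4|K|^t\sqrt{\log|K|}\le\sqrt n$, then with probability at least $1-\sqrt2/\sqrt[4]{n\log|K|}$ a representation $\rho$ drawn from the Plancherel measure on $\widehat G$ has the property that $$\Pr_{\{h^{(m)}\}}\left[\left\|\frac1t\sum_{m=1}^t\rho(h^{(m)})\right\|_{\mathrm{op}}=1\right]\ge1-\frac{\sqrt2}{\sqrt[4]{n\log|K|}},$$ where $h^{(1)},\dots,h^{(t)}$ are independent and uniform in $G$. (3) Consequently $\Omega(\log\log|G|)$ random elements are needed to bring the expected norm below any constant less than $1$: there is a constant $c>0$, depending only on $K$, such that for every $\varepsilon>0$ and all sufficiently large $n$, with probability at least $1-\varepsilon$ a representation $\rho$ drawn from the Plancherel measure on $\widehat G$, $G=K^n$, is nontrivial and satisfies $$\mathbb E_{\{h^{(m)}\}}\left\|\frac1t\sum_{m=1}^t\rho(h^{(m)})\right\|_{\mathrm{op}}>1-\varepsilon\qquad\text{for all integers } t \text{ with } 1\le t\le c\,\log\log|G|.$$ -/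

import Mathlib

open MeasureTheory ProbabilityTheory Filter

noncomputable section

/-- A finite-dimensional irreducible unitary complex representation of `G`, realized on the
standard Hilbert space `ℂ^dim`. -/
structure UnitaryIrrep (G : Type*) [Group G] where
  /-- the dimension -/
  dim : ℕ
  /-- the representation itself -/
  rep : Representation ℂ G (EuclideanSpace ℂ (Fin dim))
  /-- every group element acts by a unitary operator -/
  unitary : ∀ (g : G) (v : EuclideanSpace ℂ (Fin dim)), ‖rep g v‖ = ‖v‖
  /-- there are exactly two subrepresentations, `0` and everything (in particular `dim ≠ 0`) -/
  irreducible : rep.IsIrreducible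

/-- Isomorphism of irreducible unitary representations. -/
instance UnitaryIrrep.setoid (G : Type*) [Group G] : Setoid (UnitaryIrrep G) where
  r ρ σ := Nonempty (ρ.rep.Equiv σ.rep)
  iseqv :=
    { refl := fun ρ => ⟨Representation.Equiv.refl ρ.rep⟩
      symm := fun ⟨φ⟩ => ⟨φ.symm⟩
      trans := fun ⟨φ⟩ ⟨ψ⟩ => ⟨φ.trans ψ⟩ }

/-- The dual `Ĝ`: the set of irreducible unitary representations of `G` up to isomorphism. -/
def UnitaryDual (G : Type*) [Group G] : Type _ :=
  Quotient (UnitaryIrrep.setoid G)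

/-- The dual is a discrete measurable space. -/
instance (G : Type*) [Group G] : MeasurableSpace (UnitaryDual G) := ⊤

/-- A unitary representation in the given isomorphism class. Everything below that is computed
from it (dimension, characters, operator norms) is the same for all members of the class. -/
def UnitaryDual.out {G : Type*} [Group G] (ρ : UnitaryDual G) : UnitaryIrrep G :=
  Quotient.out ρ

/-- The Plancherel measure on `Ĝ`: the class of `ρ` has mass `(dim ρ)² / |G|`. -/
def plancherelMeasure (G : Type*) [Group G] : Measure (UnitaryDual G) :=
  Measure.sum fun ρ : UnitaryDual G =>
    ENNReal.ofReal ((ρ.out.dim : ℝ) ^ 2 / Nat.card G) • Measure.dirac ρ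

/-- The inner product `⟨φ, ψ⟩_G = |G|⁻¹ ∑ g, φ(g) ψ(g)^*` of functions on a finite group. -/
def classInner {G : Type*} [Group G] [Finite G] (φ ψ : G → ℂ) : ℂ :=
  letI := Fintype.ofFinite G
  (Nat.card G : ℂ)⁻¹ * ∑ g : G, φ g * star (ψ g)

/-- `X_H(ρ) = ⟨Res_H χ_ρ, 1⟩_H / d_ρ`, the dimensionwise fraction of `ρ` on which the subgroup `H`
acts trivially. -/
def trivialFraction {G : Type*} [Group G] [Finite G] (H : Subgroup G) (ρ : UnitaryDual G) : ℂ :=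
  classInner (G := H) (fun h => ρ.out.rep.character (h : G)) (fun _ => 1) / (ρ.out.dim : ℂ)

/-- The operator norm (with respect to the Euclidean norm) of `(1/t) ∑ m, ρ(h m)`. -/
def averageNorm {G : Type*} [Group G] {t : ℕ} (ρ : UnitaryDual G) (h : Fin t → G) : ℝ :=
  ‖LinearMap.toContinuousLinearMap ((t : ℂ)⁻¹ • ∑ m : Fin t, ρ.out.rep (h m))‖

/-- The law of `t` independent uniformly random elements of `G`. -/
def uniformTuples (G : Type*) [MeasurableSpace G] (t : ℕ) : Measure (Fin t → G) :=
  Measure.pi fun _ : Fin t => uniformOn (Set.univ : Set G)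

end

/-! The proof is a second moment argument over a subgroup that contains `H` and has simple
structure. Coordinate `i` of the `t` generators is a point `f i` of `K^t`, so `H` lies in the group
`A` of tuples constant on the fibres of `f`, a copy of `K^(range f)`. A vector fixed by `A` is fixed
by `H`; hence `X_H(ρ) = 0` forces `∑ a ∈ A, χ_ρ(a) = 0`, that is, the sum over `a ≠ 1` equals
`-d_ρ`.

Under the Plancherel measure, column orthogonality computes the second moment of that sum divided by
`d_ρ`: it is the sum over `a, b ≠ 1` in `A` of the reciprocal size of their common `G`-class, or `0`
if they are not conjugate (`conjWeight`). This bounds the probability of the event. The weights are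
multiplicative over coordinates, and trivial center makes every nontrivial class of `K` have size at
least `2`; so the sum over all pairs is at most a product over `v ∈ K^t` of `1 + 2(|K| - 1)
2^(-l_v)`, where `l_v` is the size of the fibre over `v`. For random generators `f` is a uniform
random map. Expanding the product over subsets of `K^t` and averaging gives, with `M = |K|^t`, the
bound `(1 - 1/(2M))^n (2|K| - 1)^M ≤ exp(-n/(2M) + 2M log |K|)`.

Part (1) follows from this bound, without using the term `2α/√n`. A nonzero `H`-fixed vector makes
the average have norm `1`, so Markov's inequality in `ρ` gives part (2). Part (3) is a union bound
over `t`, together with the small mass of the trivial representation. Column orthogonality itself is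
derived from row orthogonality and the completeness of characters, the latter proved in the regular
representation. -/

/-! ### Irreducible unitary representations and completeness of their characters -/

namespace Representation

/-- A representation embedded in another one with image a minimal nonzero subrepresentation is
irreducible. -/
theorem isIrreducible_of_injective_of_isAtom {k G V E : Type*} [Monoid G] [Field k]
    [AddCommGroup V] [Module k V] [AddCommGroup E] [Module k E] {σ : Representation k G E}
    {R : Representation k G V} (j : IntertwiningMap σ R) (hj : Function.Injective j)
    (hW : IsAtom j.range) : σ.IsIrreducible := by
  have hmem (U : Subrepresentation σ) (x : E) :
      x ∈ U ↔ j x ∈ U.toSubmodule.map j.toLinearMap := by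
    rw [Submodule.mem_map]
    exact ⟨fun h => ⟨x, h, rfl⟩, fun ⟨y, hy, h⟩ => hj h ▸ hy⟩
  have hj0 : ∃ x, j x ≠ 0 := by
    by_contra! h
    refine hW.1 (SetLike.ext fun w => ?_)
    rw [IntertwiningMap.mem_range]
    constructor
    · rintro ⟨x, rfl⟩
      rw [h x]
      exact Submodule.zero_mem _
    · intro hw
      exact ⟨0, by rw [map_zero]; exact ((Submodule.mem_bot k).1 hw).symm⟩
  refine { exists_pair_ne := ⟨⊥, ⊤, fun h => ?_⟩, eq_bot_or_eq_top := fun U => ?_ }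
  · obtain ⟨x, hx⟩ := hj0
    have : x ∈ (⊥ : Subrepresentation σ) := h ▸ Submodule.mem_top
    rw [show x = 0 from (Submodule.mem_bot k).1 this, map_zero] at hx
    exact hx rfl
  · let U' : Subrepresentation R :=
      { toSubmodule := U.toSubmodule.map j.toLinearMap
        apply_mem_toSubmodule := by
          rintro g _ ⟨x, hx, rfl⟩
          exact ⟨σ g x, U.apply_mem_toSubmodule g hx, IntertwiningMap.isIntertwining _ _ j g x⟩ }
    have hle : U' ≤ j.range := by
      rintro _ ⟨x, -, rfl⟩
      exact (IntertwiningMap.mem_range _ _ _ _).2 ⟨x, rfl⟩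
    rcases hW.le_iff.1 hle with h | h
    · left
      refine SetLike.ext fun x => ?_
      rw [hmem, show U.toSubmodule.map j.toLinearMap = (⊥ : Submodule k V) from
        congrArg Subrepresentation.toSubmodule h, Submodule.mem_bot,
        show x ∈ (⊥ : Subrepresentation σ) ↔ x = 0 from Submodule.mem_bot k]
      exact map_eq_zero_iff j hj
    · right
      refine SetLike.ext fun x => ?_
      rw [hmem, show U.toSubmodule.map j.toLinearMap = j.range.toSubmodule from
        congrArg Subrepresentation.toSubmodule h]
      exact iff_of_true ((IntertwiningMap.mem_range _ _ _ _).2 ⟨x, rfl⟩) Submodule.mem_top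
end Representation

namespace UnitaryIrrep

variable {G : Type*} [Group G]

instance (ρ : UnitaryIrrep G) : ρ.rep.IsIrreducible := ρ.irreducible

theorem inner_map_map (ρ : UnitaryIrrep G) (g : G) (v w : EuclideanSpace ℂ (Fin ρ.dim)) :
    inner ℂ (ρ.rep g v) (ρ.rep g w) = inner ℂ v w :=
  LinearIsometry.inner_map_map ⟨ρ.rep g, ρ.unitary g⟩ v w

theorem character_inv (ρ : UnitaryIrrep G) (g : G) :
    ρ.rep.character g⁻¹ = star (ρ.rep.character g) := by
  simp only [Representation.character,
    LinearMap.trace_eq_sum_inner _ (stdOrthonormalBasis ℂ (EuclideanSpace ℂ (Fin ρ.dim))),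
    star_sum]
  refine Finset.sum_congr rfl fun i _ => ?_
  rw [← ρ.inner_map_map g, ← Module.End.mul_apply, ← map_mul, mul_inv_cancel, map_one]
  simp

theorem character_one (ρ : UnitaryIrrep G) : ρ.rep.character 1 = ρ.dim := by simp

theorem dim_pos (ρ : UnitaryIrrep G) : 0 < ρ.dim := by
  rw [Nat.pos_iff_ne_zero]
  intro h
  have hs : Subsingleton (EuclideanSpace ℂ (Fin ρ.dim)) := by
    rw [h]; infer_instance
  obtain ⟨⟨a, b, hab⟩⟩ : Nontrivial (Subrepresentation ρ.rep) := inferInstance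
  exact hab (Subrepresentation.toSubmodule_injective (Subsingleton.elim _ _))

/-- The linear map `∑ g, f g • R g` attached to a function `f` on the group. -/
noncomputable def _root_.Representation.weightedSum {k V : Type*} [Field k] [AddCommGroup V]
    [Module k V] [Fintype G] (R : Representation k G V) (f : G → k) : V →ₗ[k] V :=
  ∑ g, f g • R g

theorem _root_.Representation.weightedSum_comm {k V : Type*} [Field k] [AddCommGroup V]
    [Module k V] [Fintype G] (R : Representation k G V) (f : G → k)
    (hf : ∀ g h, f (h * g * h⁻¹) = f g) (h : G) :
    R.weightedSum f * R h = R h * R.weightedSum f := by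
  simp only [Representation.weightedSum, Finset.sum_mul, Finset.mul_sum, smul_mul_assoc,
    mul_smul_comm, ← map_mul]
  refine Fintype.sum_equiv (MulAut.conj h⁻¹).toEquiv _ _ fun g => ?_
  have : f (h⁻¹ * g * h) = f g := by simpa using hf g h⁻¹
  simp [← this, mul_assoc]

/-- If a unitary representation `R` has a minimal nonzero invariant subspace `W`, then some
irreducible unitary representation on coordinate space embeds into `R` with image `W`. -/
theorem exists_intertwiningMap_of_isAtom {V : Type*} [NormedAddCommGroup V]
    [InnerProductSpace ℂ V] [FiniteDimensional ℂ V] (R : Representation ℂ G V)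
    (hR : ∀ g v, ‖R g v‖ = ‖v‖) (W : Subrepresentation R) (hW : IsAtom W) :
    ∃ (ρ : UnitaryIrrep G) (j : Representation.IntertwiningMap ρ.rep R), j.range = W := by
  -- Orthonormal coordinates keep the transported action unitary.
  let e := (stdOrthonormalBasis ℂ W.toSubmodule).repr
  let σ : Representation ℂ G (EuclideanSpace ℂ (Fin (Module.finrank ℂ W.toSubmodule))) :=
    { toFun := fun g =>
        e.toLinearEquiv.toLinearMap ∘ₗ W.toRepresentation g ∘ₗ e.symm.toLinearEquiv.toLinearMap
      map_one' := by ext1 v; simp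
      map_mul' := fun g h => by ext1 v; simp }
  have hσ (g v) : σ g v = e (W.toRepresentation g (e.symm v)) := rfl
  let j : Representation.IntertwiningMap σ R :=
    { toLinearMap := W.toSubmodule.subtype ∘ₗ e.symm.toLinearEquiv.toLinearMap
      isIntertwining' := fun g => by
        ext1 v
        change ((e.symm (e (W.toRepresentation g (e.symm v))) : W.toSubmodule) : V) = _
        rw [e.symm_apply_apply]
        rfl }
  have hj (v) : j v = (e.symm v : W.toSubmodule) := rfl
  have hrange : j.range = W := by
    refine SetLike.ext fun w => ?_
    rw [Representation.IntertwiningMap.mem_range]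
    constructor
    · rintro ⟨v, rfl⟩
      exact (e.symm v).2
    · intro hw
      exact ⟨e ⟨w, hw⟩, by rw [hj, e.symm_apply_apply]⟩
  refine ⟨⟨_, σ, fun g v => ?_, Representation.isIrreducible_of_injective_of_isAtom j ?_ ?_⟩,
    j, hrange⟩
  · rw [hσ, e.norm_map]
    exact (hR g (e.symm v)).trans (e.symm.norm_map v)
  · intro v w h
    exact e.symm.injective (Subtype.ext h)
  · rwa [hrange]

/-- Schur's lemma: `∑ g, f g • ρ g = 0` for an irreducible `ρ` and a class function `f` orthogonal
to its character. -/
theorem weightedSum_eq_zero [Fintype G] (ρ : UnitaryIrrep G) (f : G → ℂ)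
    (hf : ∀ g h, f (h * g * h⁻¹) = f g) (h0 : ∑ g, f g * ρ.rep.character g = 0) :
    ρ.rep.weightedSum f = 0 := by
  let T : Representation.IntertwiningMap ρ.rep ρ.rep :=
    ⟨ρ.rep.weightedSum f, fun g => ρ.rep.weightedSum_comm f hf g⟩
  -- Over `ℂ` the intertwiner is a scalar `c`; taking traces, `c * dim` is the vanishing pairing of
  -- `f` with the character.
  obtain ⟨c, hc⟩ :=
    Representation.IsIrreducible.algebraMap_intertwiningMap_bijective_of_isAlgClosed.2 T
  have hT : ρ.rep.weightedSum f = c • LinearMap.id :=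
    (congrArg Representation.IntertwiningMap.toLinearMap hc).symm
  have htr := congrArg (LinearMap.trace ℂ _) hT
  rw [map_smul, LinearMap.trace_id, Representation.weightedSum, map_sum] at htr
  simp only [map_smul, smul_eq_mul] at htr
  rw [show ∑ g, f g * LinearMap.trace ℂ _ (ρ.rep g) = 0 from h0] at htr
  have hc0 : c = 0 := by
    have := ρ.dim_pos.ne'
    simpa [this] using htr.symm
  rw [hT, hc0, zero_smul]

/-- The left regular representation on the Hilbert space of functions on `G`. -/
noncomputable def _root_.Representation.regularUnitary (G : Type*) [Group G] :
    Representation ℂ G (EuclideanSpace ℂ G) where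
  toFun g :=
    { toFun := fun v => WithLp.toLp 2 fun x => v (g⁻¹ * x)
      map_add' := fun v w => rfl
      map_smul' := fun c v => rfl }
  map_one' := by ext v x; simp
  map_mul' g h := by ext v x; simp only [mul_inv_rev, mul_assoc]; rfl

/-- A class function orthogonal to all irreducible characters vanishes. -/
theorem eq_zero_of_forall_sum_character_eq_zero [Fintype G] (f : G → ℂ)
    (hf : ∀ g h, f (h * g * h⁻¹) = f g)
    (h0 : ∀ ρ : UnitaryIrrep G, ∑ g, f g * ρ.rep.character g = 0) : f = 0 := by
  classical
  set R := Representation.regularUnitary G with hRdef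
  have hRapp (g : G) (v : EuclideanSpace ℂ G) (x : G) : R g v x = v (g⁻¹ * x) := rfl
  have hR (g : G) (v : EuclideanSpace ℂ G) : ‖R g v‖ = ‖v‖ := by
    rw [EuclideanSpace.norm_eq, EuclideanSpace.norm_eq]
    congr 1
    exact Fintype.sum_equiv (Equiv.mulLeft g⁻¹) _ _ fun x => rfl
  let N : Subrepresentation R :=
    { toSubmodule := LinearMap.ker (R.weightedSum f)
      apply_mem_toSubmodule := fun g v hv => by
        have := congrArg (fun T => T v) (R.weightedSum_comm f hf g)
        simp only [Module.End.mul_apply] at this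
        rw [LinearMap.mem_ker] at hv ⊢
        rw [this, hv, map_zero] }
  -- By Maschke the kernel has an invariant complement. If nonzero, it contains an irreducible `W`;
  -- Schur's lemma makes `R.weightedSum f` kill `W`, so `W` also lies in the kernel, a
  -- contradiction.
  have hN : N = ⊤ := by
    have : NeZero (Nat.card G : ℂ) := ⟨by simp⟩
    obtain ⟨C, hC⟩ := exists_isCompl N
    have : IsAtomic (Subrepresentation R) := by
      refine isAtomic_of_orderBot_wellFounded_lt ?_
      exact (InvImage.wf Subrepresentation.toSubmodule
        (wellFounded_lt (α := Submodule ℂ (EuclideanSpace ℂ G)))).mono fun a b h => h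
    rcases eq_bot_or_exists_atom_le C with h | ⟨W, hW, hWC⟩
    · rw [h] at hC
      exact eq_top_of_isCompl_bot hC
    · obtain ⟨ρ, j, hj⟩ := exists_intertwiningMap_of_isAtom R hR W hW
      have hWN : W ≤ N := by
        intro w hw
        rw [← hj, Representation.IntertwiningMap.mem_range] at hw
        obtain ⟨v, rfl⟩ := hw
        change R.weightedSum f (j v) = 0
        have : R.weightedSum f (j v) = j (ρ.rep.weightedSum f v) := by
          simp [Representation.weightedSum, Representation.IntertwiningMap.isIntertwining]
        rw [this, ρ.weightedSum_eq_zero f hf (h0 ρ), LinearMap.zero_apply, map_zero]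
      exact absurd (le_bot_iff.1 (hC.disjoint hWN hWC)) hW.1
  -- Applied to the delta function at `1`, the operator returns `f` itself.
  have hδ : R.weightedSum f (EuclideanSpace.single 1 1) = 0 := by
    have : EuclideanSpace.single (1 : G) (1 : ℂ) ∈ N := hN ▸ Submodule.mem_top
    exact this
  funext x
  have := congrArg (fun v : EuclideanSpace ℂ G => v x) hδ
  simpa [Representation.weightedSum, hRapp, inv_mul_eq_one] using this

end UnitaryIrrep

/-! ### Orthogonality relations on the unitary dual -/

open scoped Classical in
theorem natCard_conjugatesOf {G : Type*} [Group G] [Fintype G] (h : G) :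
    Nat.card (conjugatesOf h) = (Finset.univ.filter fun x => IsConj h x).card :=
  Nat.subtype_card _ fun x => by
    rw [Finset.mem_filter]
    exact and_iff_right (Finset.mem_univ x)

theorem natCard_conjugatesOf_pos {G : Type*} [Group G] [Finite G] (h : G) :
    0 < Nat.card (conjugatesOf h) := by
  have : Nonempty (conjugatesOf h) := ⟨⟨h, mem_conjugatesOf_self⟩⟩
  exact Nat.card_pos

theorem isConj_mul_mul_inv {G : Type*} [Group G] (x y : G) : IsConj x (y * x * y⁻¹) :=
  isConj_iff.2 ⟨y, rfl⟩

namespace UnitaryDual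

variable {G : Type*} [Group G]

/-- The character of a class of irreducible unitary representations. -/
noncomputable def character (ρ : UnitaryDual G) : G → ℂ := ρ.out.rep.character

/-- The dimension of a class of irreducible unitary representations. -/
noncomputable def dim (ρ : UnitaryDual G) : ℕ := ρ.out.dim

theorem dim_pos (ρ : UnitaryDual G) : 0 < ρ.dim := ρ.out.dim_pos

theorem character_one (ρ : UnitaryDual G) : ρ.character 1 = ρ.dim := ρ.out.character_one

theorem character_conj (ρ : UnitaryDual G) (g h : G) :
    ρ.character (h * g * h⁻¹) = ρ.character g :=
  Representation.char_conj _ _ _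

theorem character_eq_of_isConj (ρ : UnitaryDual G) {g h : G} (hgh : IsConj g h) :
    ρ.character g = ρ.character h := by
  obtain ⟨c, rfl⟩ := isConj_iff.1 hgh
  rw [character_conj]

theorem exists_character_eq (τ : UnitaryIrrep G) :
    ∃ ρ : UnitaryDual G, ρ.character = τ.rep.character := by
  refine ⟨Quotient.mk _ τ, ?_⟩
  obtain ⟨φ⟩ := Quotient.mk_out (s := UnitaryIrrep.setoid G) τ
  exact Representation.char_iso φ

open scoped Classical in
/-- Row orthogonality. -/
theorem sum_character_mul_star_character [Fintype G] (ρ σ : UnitaryDual G) :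
    ∑ g, ρ.character g * star (σ.character g) = if ρ = σ then (Nat.card G : ℂ) else 0 := by
  have hG : (Nat.card G : ℂ) ≠ 0 := by simp
  have := invertibleOfNonzero hG
  have h := Representation.char_orthonormal ρ.out.rep σ.out.rep
  simp only [UnitaryIrrep.character_inv] at h
  rw [inv_mul_eq_iff_eq_mul₀ hG] at h
  have hiff : Nonempty (σ.out.rep.Equiv ρ.out.rep) ↔ ρ = σ := by
    rw [@eq_comm _ ρ σ]
    exact Quotient.out_equiv_out (s := UnitaryIrrep.setoid G)
  simp only [hiff] at h
  refine h.trans ?_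
  split_ifs <;> simp

/-- Row orthogonality makes the characters nonzero and pairwise orthogonal, hence linearly
independent, in a space of dimension `|G|`. -/
instance [Finite G] : Finite (UnitaryDual G) := by
  classical
  have := Fintype.ofFinite G
  have hG : (Nat.card G : ℂ) ≠ 0 := by simp
  have hinner (ρ σ : UnitaryDual G) :
      inner ℂ (WithLp.toLp 2 σ.character : EuclideanSpace ℂ G) (WithLp.toLp 2 ρ.character) =
        if ρ = σ then (Nat.card G : ℂ) else 0 := by
    rw [← sum_character_mul_star_character, PiLp.inner_apply]
    rfl
  refine (linearIndependent_of_ne_zero_of_inner_eq_zero (𝕜 := ℂ)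
    (v := fun ρ : UnitaryDual G => (WithLp.toLp 2 ρ.character : EuclideanSpace ℂ G))
    (fun ρ h => ?_) fun ρ σ h => ?_).finite
  · have := hinner ρ ρ
    rw [h, inner_zero_left, if_pos rfl] at this
    exact hG this.symm
  · exact (hinner σ ρ).trans (if_neg h.symm)

open scoped Classical in
/-- Column orthogonality. -/
theorem sum_character_mul_star_character_eq [Finite G] [Fintype (UnitaryDual G)] (g h : G) :
    ∑ ρ : UnitaryDual G, ρ.character g * star (ρ.character h) =
      if IsConj g h then (Nat.card G : ℂ) / Nat.card (conjugatesOf g) else 0 := by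
  have := Fintype.ofFinite G
  have hc : (Nat.card (conjugatesOf h) : ℂ) ≠ 0 := by
    exact_mod_cast (natCard_conjugatesOf_pos h).ne'
  -- The difference of the two sides as a class function of `x`. It is conjugated so that its
  -- bilinear pairing with a character becomes, up to `star`, the Hermitian pairing of row
  -- orthogonality.
  let F : G → ℂ := fun x => star ((if IsConj x h then (Nat.card G : ℂ) / Nat.card (conjugatesOf h)
    else 0) - ∑ ρ : UnitaryDual G, ρ.character x * star (ρ.character h))
  have hF : F = 0 := by
    refine UnitaryIrrep.eq_zero_of_forall_sum_character_eq_zero F (fun x y => ?_) fun τ => ?_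
    · have : IsConj (y * x * y⁻¹) h ↔ IsConj x h :=
        ⟨fun H => (isConj_mul_mul_inv x y).trans H,
          fun H => (isConj_mul_mul_inv x y).symm.trans H⟩
      simp only [F, this, character_conj]
    · obtain ⟨σ, hσ⟩ := exists_character_eq τ
      rw [← hσ, ← star_eq_zero]
      have h1 : ∑ x, (if IsConj x h then (Nat.card G : ℂ) / Nat.card (conjugatesOf h) else 0) *
          star (σ.character x) = Nat.card G * star (σ.character h) := by
        have (x : G) : (if IsConj x h then (Nat.card G : ℂ) / Nat.card (conjugatesOf h) else 0) *
            star (σ.character x) = if IsConj h x then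
              (Nat.card G : ℂ) / Nat.card (conjugatesOf h) * star (σ.character h) else 0 := by
          by_cases H : IsConj h x
          · rw [if_pos H, if_pos H.symm, σ.character_eq_of_isConj H]
          · rw [if_neg H, if_neg fun H' => H H'.symm, zero_mul]
        rw [Finset.sum_congr rfl fun x _ => this x, ← Finset.sum_filter, Finset.sum_const,
          nsmul_eq_mul, ← natCard_conjugatesOf]
        field_simp
      have h2 : ∑ x, (∑ ρ : UnitaryDual G, ρ.character x * star (ρ.character h)) *
          star (σ.character x) = Nat.card G * star (σ.character h) := by
        simp only [Finset.sum_mul]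
        rw [Finset.sum_comm]
        have (ρ : UnitaryDual G) :
            ∑ x, ρ.character x * star (ρ.character h) * star (σ.character x) =
              (if ρ = σ then (Nat.card G : ℂ) else 0) * star (ρ.character h) := by
          rw [← sum_character_mul_star_character, Finset.sum_mul]
          exact Finset.sum_congr rfl fun x _ => by ring
        rw [Finset.sum_congr rfl fun ρ _ => this ρ]
        simp
      simp only [F, star_sum, star_mul', star_star, sub_mul, Finset.sum_sub_distrib, h1]
      rw [h2, sub_self]
  have := congrArg star (congrFun hF g)
  simp only [F, star_star, Pi.zero_apply, star_zero] at this
  rw [← sub_eq_zero.1 this]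
  split_ifs with H
  · rw [H.conjugatesOf_eq]
  · rfl

end UnitaryDual

/-! ### Second moments of characters under the Plancherel measure -/

open scoped Classical in
/-- The reciprocal of the size of the common conjugacy class of two conjugate elements, and `0` for
elements that are not conjugate. -/
noncomputable def conjWeight {G : Type*} [Group G] (g h : G) : ℝ :=
  if IsConj g h then (Nat.card (conjugatesOf g) : ℝ)⁻¹ else 0

theorem natCard_conjugatesOf_one (G : Type*) [Group G] :
    Nat.card (conjugatesOf (1 : G)) = 1 := by
  have h1 : conjugatesOf (1 : G) = {1} := by
    ext x
    exact isConj_one_right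
  simp [h1]

theorem conjWeight_self {G : Type*} [Group G] (g : G) :
    conjWeight g g = (Nat.card (conjugatesOf g) : ℝ)⁻¹ :=
  if_pos (IsConj.refl g)

theorem conjWeight_one_left {G : Type*} [Group G] {g : G} (hg : g ≠ 1) : conjWeight 1 g = 0 :=
  if_neg fun h => hg (isConj_one_right.1 h)

theorem conjWeight_one_right {G : Type*} [Group G] {g : G} (hg : g ≠ 1) : conjWeight g 1 = 0 :=
  if_neg fun h => hg (isConj_one_left.1 h)

namespace UnitaryDual

variable {G : Type*} [Group G]

open scoped Classical in
theorem plancherelMeasure_real [Finite G] [Fintype (UnitaryDual G)] (S : Set (UnitaryDual G)) :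
    (plancherelMeasure G).real S =
      ∑ ρ : UnitaryDual G, if ρ ∈ S then (ρ.dim : ℝ) ^ 2 / Nat.card G else 0 := by
  rw [measureReal_def, plancherelMeasure, Measure.sum_apply _ (MeasurableSpace.measurableSet_top),
    tsum_fintype, ENNReal.toReal_sum]
  · refine Finset.sum_congr rfl fun ρ _ => ?_
    rw [Measure.smul_apply, Measure.dirac_apply, smul_eq_mul, ENNReal.toReal_mul,
      ENNReal.toReal_ofReal (by positivity)]
    by_cases h : ρ ∈ S <;> simp [h, dim]
  · intro ρ _
    rw [Measure.smul_apply, Measure.dirac_apply, smul_eq_mul]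
    by_cases h : ρ ∈ S <;> simp [h]

/-- Expand the square and apply column orthogonality to each pair. -/
theorem sum_normSq_sum_character [Finite G] [Fintype (UnitaryDual G)] {A : Type*} (B : Finset A)
    (ι : A → G) :
    ∑ ρ : UnitaryDual G, ‖∑ a ∈ B, ρ.character (ι a)‖ ^ 2 = Nat.card G *
      ∑ a ∈ B, ∑ b ∈ B, conjWeight (ι a) (ι b) := by
  have h (ρ : UnitaryDual G) : ((‖∑ a ∈ B, ρ.character (ι a)‖ ^ 2 : ℝ) : ℂ) =
      ∑ a ∈ B, ∑ b ∈ B, ρ.character (ι a) * star (ρ.character (ι b)) := by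
    rw [← Finset.sum_mul_sum, ← star_sum]
    push_cast
    exact (Complex.mul_conj' _).symm
  rw [← Complex.ofReal_inj, Complex.ofReal_sum, Finset.sum_congr rfl fun ρ _ => h ρ,
    Finset.sum_comm]
  push_cast
  rw [Finset.mul_sum]
  refine Finset.sum_congr rfl fun a _ => ?_
  rw [Finset.sum_comm, Finset.mul_sum]
  refine Finset.sum_congr rfl fun b _ => ?_
  rw [sum_character_mul_star_character_eq, conjWeight]
  split_ifs <;> simp [div_eq_mul_inv]

/-- Column orthogonality at the identity reads `∑ ρ, d_ρ² = |G|`. -/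
instance [Finite G] : IsProbabilityMeasure (plancherelMeasure G) := by
  classical
  have := Fintype.ofFinite (UnitaryDual G)
  have hG : (Nat.card G : ℝ) ≠ 0 := Nat.cast_ne_zero.2 Nat.card_pos.ne'
  have h := sum_normSq_sum_character ({1} : Finset G) id
  simp only [Finset.sum_singleton, id_eq, conjWeight_self, natCard_conjugatesOf_one,
    character_one, Complex.norm_natCast, Nat.cast_one, inv_one, mul_one] at h
  rw [isProbabilityMeasure_iff_real, plancherelMeasure_real]
  simp only [Set.mem_univ, if_true]
  rw [← Finset.sum_div, h, div_self hG]

/-- The second moment bound for the multiplicity of the trivial representation of a subgroup. -/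
theorem plancherelMeasure_real_sum_character_eq_zero_le [Finite G] {A : Type*} [Group A]
    [Fintype A] (ι : A →* G) (hι : Function.Injective ι) :
    (plancherelMeasure G).real {ρ | ∑ a, ρ.character (ι a) = 0} ≤
      (∑ a, ∑ b, conjWeight (ι a) (ι b)) - 1 := by
  classical
  have := Fintype.ofFinite (UnitaryDual G)
  have hG : (0 : ℝ) < Nat.card G := by exact_mod_cast Nat.card_pos
  set c : A → A → ℝ := fun a b => conjWeight (ι a) (ι b) with hc
  have hc1 (b : A) (hb : b ≠ 1) : c 1 b = 0 := by
    simp only [hc, map_one]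
    exact conjWeight_one_left ((map_ne_one_iff ι hι).2 hb)
  have hc2 (b : A) (hb : b ≠ 1) : c b 1 = 0 := by
    simp only [hc, map_one]
    exact conjWeight_one_right ((map_ne_one_iff ι hι).2 hb)
  have hc3 : c 1 1 = 1 := by
    simp only [hc, map_one, conjWeight_self, natCard_conjugatesOf_one, Nat.cast_one, inv_one]
  -- The identity is conjugate only to itself, so its row and column contribute exactly the `1` that
  -- is subtracted.
  have hsum : ∑ a, ∑ b, c a b =
      1 + ∑ a ∈ Finset.univ.erase 1, ∑ b ∈ Finset.univ.erase 1, c a b := by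
    rw [← Finset.add_sum_erase _ _ (Finset.mem_univ (1 : A)),
      ← Finset.add_sum_erase _ _ (Finset.mem_univ (1 : A)), hc3,
      Finset.sum_eq_zero (s := Finset.univ.erase 1) fun b hb => hc1 b (Finset.ne_of_mem_erase hb),
      add_zero]
    congr 1
    refine Finset.sum_congr rfl fun a ha => ?_
    rw [← Finset.add_sum_erase _ _ (Finset.mem_univ (1 : A)),
      hc2 a (Finset.ne_of_mem_erase ha), zero_add]
  rw [hsum, add_sub_cancel_left, plancherelMeasure_real]
  have key := sum_normSq_sum_character (Finset.univ.erase 1) ι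
  rw [mul_comm, ← div_eq_iff hG.ne'] at key
  rw [← key, Finset.sum_div]
  refine Finset.sum_le_sum fun ρ _ => ?_
  split_ifs with h
  -- On the event, the sum over `a ≠ 1` is `-d_ρ`, so the Plancherel mass equals the second moment
  -- term.
  · rw [Set.mem_ofPred_eq, ← Finset.add_sum_erase _ _ (Finset.mem_univ (1 : A)), map_one,
      character_one, add_comm, add_eq_zero_iff_eq_neg] at h
    rw [h]
    simp
  · positivity

/-- The mass of the trivial class, bounded by the second moment of the character at any `g`. -/
theorem plancherelMeasure_real_forall_rep_eq_one_le [Finite G] (g : G) :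
    (plancherelMeasure G).real {ρ | ∀ g, ρ.out.rep g = 1} ≤
      (Nat.card (conjugatesOf g) : ℝ)⁻¹ := by
  classical
  have := Fintype.ofFinite (UnitaryDual G)
  have hG : (0 : ℝ) < Nat.card G := by exact_mod_cast Nat.card_pos
  have key := sum_normSq_sum_character ({g} : Finset G) id
  simp only [Finset.sum_singleton, id_eq, conjWeight_self] at key
  rw [mul_comm, ← div_eq_iff hG.ne'] at key
  rw [plancherelMeasure_real, ← key, Finset.sum_div]
  refine Finset.sum_le_sum fun ρ _ => ?_
  split_ifs with h
  · have : ρ.character g = ρ.dim := by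
      rw [← character_one]
      simp only [character, Representation.character, h.out g, h.out 1]
    rw [this]
    simp
  · positivity

/-- The multiplicity of the trivial representation in a restriction. -/
theorem sum_character_comp_eq_zero_iff {A : Type*} [Group A] [Fintype A] (ι : A →* G)
    (ρ : UnitaryDual G) :
    ∑ a, ρ.character (ι a) = 0 ↔
      Representation.invariants (ρ.out.rep.comp ι : Representation ℂ A _) = ⊥ := by
  have hA : (Nat.card A : ℂ) ≠ 0 := by simp
  have := invertibleOfNonzero hA
  have h := Representation.card_inv_mul_sum_char_eq_finrank
    (ρ.out.rep.comp ι : Representation ℂ A _)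
  rw [← Submodule.finrank_eq_zero (R := ℂ), ← Nat.cast_eq_zero (R := ℂ), ← h, mul_eq_zero,
    or_iff_right (inv_ne_zero hA)]
  rfl

theorem trivialFraction_eq_zero_iff [Finite G] (H : Subgroup G) (ρ : UnitaryDual G) :
    trivialFraction H ρ = 0 ↔
      Representation.invariants (ρ.out.rep.comp H.subtype : Representation ℂ H _) = ⊥ := by
  have := Fintype.ofFinite H
  have hd : (ρ.out.dim : ℂ) ≠ 0 := by exact_mod_cast ρ.dim_pos.ne'
  have hH : (Nat.card H : ℂ) ≠ 0 := by simp
  rw [← sum_character_comp_eq_zero_iff, trivialFraction, div_eq_zero_iff, or_iff_left hd,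
    classInner, mul_eq_zero, or_iff_right (inv_ne_zero hH)]
  simp only [star_one, mul_one]
  rw [Subsingleton.elim (Fintype.ofFinite H) this]
  rfl

/-- Enlarging the acting group can only shrink the space of invariants. -/
theorem sum_character_eq_zero_of_trivialFraction_eq_zero [Finite G] {A : Type*} [Group A]
    [Fintype A] (ι : A →* G) {H : Subgroup G} (hH : H ≤ ι.range) (ρ : UnitaryDual G)
    (h : trivialFraction H ρ = 0) : ∑ a, ρ.character (ι a) = 0 := by
  rw [sum_character_comp_eq_zero_iff, eq_bot_iff]
  rw [trivialFraction_eq_zero_iff] at h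
  rw [← h]
  rintro v hv ⟨x, hx⟩
  obtain ⟨a, rfl⟩ := hH hx
  exact hv a

theorem averageNorm_le_one {t : ℕ} (ρ : UnitaryDual G) (h : Fin t → G) : averageNorm ρ h ≤ 1 := by
  refine ContinuousLinearMap.opNorm_le_bound _ zero_le_one fun v => ?_
  rw [LinearMap.coe_toContinuousLinearMap', LinearMap.smul_apply, norm_smul, LinearMap.sum_apply,
    one_mul]
  have h1 : ‖∑ m, ρ.out.rep (h m) v‖ ≤ t * ‖v‖ := by
    refine (norm_sum_le _ _).trans ?_
    simp [ρ.out.unitary]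
  rcases Nat.eq_zero_or_pos t with rfl | ht
  · simp
  · have ht' : (0 : ℝ) < t := by exact_mod_cast ht
    rw [norm_inv, Complex.norm_natCast, inv_mul_le_iff₀ ht']
    exact h1

/-- A nonzero vector fixed by every `h m` is fixed by their average, and an average of unitaries has
norm at most `1`. -/
theorem averageNorm_eq_one_of_trivialFraction_ne_zero [Finite G] {t : ℕ} (ht : 1 ≤ t)
    (ρ : UnitaryDual G) (h : Fin t → G)
    (hX : trivialFraction (Subgroup.closure (Set.range h)) ρ ≠ 0) : averageNorm ρ h = 1 := by
  refine le_antisymm (averageNorm_le_one ρ h) ?_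
  rw [Ne, trivialFraction_eq_zero_iff] at hX
  obtain ⟨v, hv, hv0⟩ := Submodule.exists_mem_ne_zero_of_ne_bot hX
  have hfix (m : Fin t) : ρ.out.rep (h m) v = v :=
    hv ⟨h m, Subgroup.subset_closure ⟨m, rfl⟩⟩
  have ht' : (t : ℂ) ≠ 0 := by exact_mod_cast (by omega : t ≠ 0)
  have := (LinearMap.toContinuousLinearMap
    ((t : ℂ)⁻¹ • ∑ m : Fin t, ρ.out.rep (h m))).le_opNorm v
  rw [LinearMap.coe_toContinuousLinearMap', LinearMap.smul_apply, LinearMap.sum_apply,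
    Finset.sum_congr rfl fun m _ => hfix m, Finset.sum_const, Finset.card_univ, Fintype.card_fin,
    ← Nat.cast_smul_eq_nsmul ℂ, smul_smul, inv_mul_cancel₀ ht', one_smul] at this
  exact (le_mul_iff_one_le_left (norm_pos_iff.2 hv0)).1 this

end UnitaryDual

/-! ### Conjugacy weights in powers of a group with trivial center -/

/-- Conjugacy in a power is coordinatewise, so classes are products of classes. -/
theorem conjWeight_pi {I : Type*} [Fintype I] {K : Type*} [Group K] [Finite K] (d e : I → K) :
    conjWeight d e = ∏ i, conjWeight (d i) (e i) := by
  have hconj (e : I → K) : IsConj d e ↔ ∀ i, IsConj (d i) (e i) := by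
    simp only [isConj_iff]
    constructor
    · rintro ⟨c, rfl⟩ i
      exact ⟨c i, rfl⟩
    · intro h
      choose c hc using h
      exact ⟨c, funext hc⟩
  by_cases h : ∀ i, IsConj (d i) (e i)
  · rw [conjWeight, if_pos ((hconj e).2 h)]
    have hcard : Nat.card (conjugatesOf d) = ∏ i, Nat.card (conjugatesOf (d i)) := by
      rw [← Nat.card_pi]
      exact Nat.card_congr ((Equiv.subtypeEquivRight hconj).trans Equiv.subtypePiEquivPi)
    rw [hcard]
    push_cast
    rw [← Finset.prod_inv_distrib]
    exact Finset.prod_congr rfl fun i _ => (if_pos (h i)).symm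
  · rw [conjWeight, if_neg fun H => h ((hconj e).1 H)]
    push Not at h
    obtain ⟨i, hi⟩ := h
    exact (Finset.prod_eq_zero (Finset.mem_univ i) (if_neg hi)).symm

theorem two_le_natCard_conjugatesOf {K : Type*} [Group K] [Finite K]
    (hZ : Subgroup.center K = ⊥) {k : K} (hk : k ≠ 1) : 2 ≤ Nat.card (conjugatesOf k) := by
  have hnc : k ∉ Subgroup.center K := by
    rwa [hZ, Subgroup.mem_bot]
  rw [Subgroup.mem_center_iff] at hnc
  push Not at hnc
  obtain ⟨g, hg⟩ := hnc
  have : Nontrivial (conjugatesOf k) :=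
    ⟨⟨k, mem_conjugatesOf_self⟩, ⟨g * k * g⁻¹, isConj_mul_mul_inv k g⟩, fun h => hg <| by
      have h' : k = g * k * g⁻¹ := congrArg Subtype.val h
      rw [eq_mul_inv_iff_mul_eq] at h'
      exact h'.symm⟩
  exact Finite.one_lt_card

/-- The sum over all pairs of a power of `conjWeight`, for a group with trivial center. -/
theorem sum_conjWeight_pow_le {K : Type*} [Group K] [Fintype K]
    (hZ : Subgroup.center K = ⊥) {l : ℕ} (hl : 1 ≤ l) :
    ∑ k : K, ∑ k' : K, conjWeight k k' ^ l ≤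
      1 + 2 * ((Nat.card K : ℝ) - 1) * (1 / 2 : ℝ) ^ l := by
  classical
  obtain ⟨l, rfl⟩ := Nat.exists_eq_add_of_le' hl
  -- A row has as many nonzero terms as the class of `k` has elements, which cancels one power. This
  -- is why `1 ≤ l` is needed and why the final bound carries a factor `2`.
  have hrow (k : K) : ∑ k' : K, conjWeight k k' ^ (l + 1) =
      (Nat.card (conjugatesOf k) : ℝ)⁻¹ ^ l := by
    have hk : (Nat.card (conjugatesOf k) : ℝ) ≠ 0 := by
      exact_mod_cast (natCard_conjugatesOf_pos k).ne'
    have (k' : K) : conjWeight k k' ^ (l + 1) =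
        if IsConj k k' then (Nat.card (conjugatesOf k) : ℝ)⁻¹ ^ (l + 1) else 0 := by
      by_cases h : IsConj k k' <;> simp [conjWeight]
    rw [Finset.sum_congr rfl fun k' _ => this k', ← Finset.sum_filter, Finset.sum_const,
      nsmul_eq_mul, pow_succ', ← mul_assoc]
    rw [show (Finset.univ.filter fun x => IsConj k x).card = Nat.card (conjugatesOf k) by
      rw [natCard_conjugatesOf], mul_inv_cancel₀ hk, one_mul]
  simp only [hrow]
  rw [← Finset.add_sum_erase _ _ (Finset.mem_univ (1 : K)), natCard_conjugatesOf_one]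
  have hle : ∑ k ∈ Finset.univ.erase (1 : K), (Nat.card (conjugatesOf k) : ℝ)⁻¹ ^ l ≤
      ∑ k ∈ Finset.univ.erase (1 : K), (1 / 2 : ℝ) ^ l := by
    refine Finset.sum_le_sum fun k hk => pow_le_pow_left₀ (by positivity) ?_ _
    rw [one_div]
    have h2 := two_le_natCard_conjugatesOf hZ (Finset.ne_of_mem_erase hk)
    exact inv_anti₀ two_pos (by exact_mod_cast h2)
  rw [Finset.sum_const, Finset.card_erase_of_mem (Finset.mem_univ _), Finset.card_univ,
    nsmul_eq_mul, Nat.cast_sub Fintype.card_pos, ← Nat.card_eq_fintype_card, Nat.cast_one] at hle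
  simp only [Nat.cast_one, inv_one, one_pow]
  rw [pow_succ]
  linarith

/-- Functions on `I` that are constant on the fibres of `f : I → V`. -/
def fibrewiseHom {I V : Type*} (K : Type*) [Group K] (f : I → V) :
    (Set.range f → K) →* (I → K) where
  toFun φ i := φ (Set.rangeFactorization f i)
  map_one' := rfl
  map_mul' _ _ := rfl

/-- The domain consists of functions on the range of `f`, not on all of `V`: values off the range
would be lost. -/
theorem fibrewiseHom_injective {I V : Type*} (K : Type*) [Group K] (f : I → V) :
    Function.Injective (fibrewiseHom K f) :=
  Set.rangeFactorization_surjective.injective_comp_right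

/-- The weight of a pair of fibrewise constant tuples is a product over fibres, so the double sum
factors into one-variable sums bounded by `sum_conjWeight_pow_le`. The product is extended to all of
`V` so that its index set no longer depends on `f`. -/
theorem sum_conjWeight_fibrewiseHom_le {I V K : Type*} [Fintype I] [Fintype V] [Group K]
    [Fintype K] (hZ : Subgroup.center K = ⊥) (f : I → V) [hfin : Fintype (Set.range f → K)] :
    ∑ φ : Set.range f → K, ∑ ψ : Set.range f → K,
        conjWeight (fibrewiseHom K f φ) (fibrewiseHom K f ψ) ≤
      ∏ v : V, (1 + 2 * ((Nat.card K : ℝ) - 1) * (1 / 2 : ℝ) ^ Nat.card {i // f i = v}) := by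
  classical
  have hnat (v : V) : Nat.card {i // f i = v} = Fintype.card {i // f i = v} :=
    Nat.card_eq_fintype_card
  simp only [hnat]
  have hfac (φ ψ : Set.range f → K) : conjWeight (fibrewiseHom K f φ) (fibrewiseHom K f ψ) =
      ∏ v : Set.range f, conjWeight (φ v) (ψ v) ^ Fintype.card {i // f i = v} := by
    rw [conjWeight_pi, ← Fintype.prod_fiberwise (Set.rangeFactorization f)]
    refine Finset.prod_congr rfl fun v _ => ?_
    have (i : {i // Set.rangeFactorization f i = v}) :
        conjWeight (fibrewiseHom K f φ i) (fibrewiseHom K f ψ i) = conjWeight (φ v) (ψ v) := by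
      obtain ⟨i, rfl⟩ := i
      rfl
    rw [Finset.prod_congr rfl fun i _ => this i, Finset.prod_const, Finset.card_univ]
    congr 1
    exact Fintype.card_congr (Equiv.subtypeEquivRight fun i => Subtype.ext_iff)
  have hone : (1 : ℝ) ≤ Nat.card K := by exact_mod_cast Nat.card_pos
  simp only [hfac]
  rw [Subsingleton.elim hfin Pi.instFintype]
  calc _ = ∏ v : Set.range f, ∑ k : K, ∑ k' : K,
        conjWeight k k' ^ Fintype.card {i // f i = v} := by
        simp only [Fintype.prod_sum]
    _ ≤ ∏ v : Set.range f,
        (1 + 2 * ((Nat.card K : ℝ) - 1) * (1 / 2 : ℝ) ^ Fintype.card {i // f i = v}) := by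
        refine Finset.prod_le_prod (fun v _ => ?_) fun v _ => ?_
        · refine Finset.sum_nonneg fun k _ => Finset.sum_nonneg fun k' _ => pow_nonneg ?_ _
          rw [conjWeight]
          split_ifs <;> positivity
        · obtain ⟨_, i, rfl⟩ := v
          exact sum_conjWeight_pow_le hZ (Fintype.card_pos_iff.2 ⟨⟨i, rfl⟩⟩)
    -- The added factors, for empty fibres, are at least `1`.
    _ ≤ _ := by
        have hfilter : ∀ v, v ∈ Finset.univ.filter (· ∈ Set.range f) ↔ v ∈ Set.range f := by
          simp
        rw [← Finset.prod_subtype _ hfilter fun v =>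
          1 + 2 * ((Nat.card K : ℝ) - 1) * (1 / 2 : ℝ) ^ Fintype.card {i // f i = v},
          Finset.prod_filter]
        refine Finset.prod_le_prod (fun v _ => ?_) fun v _ => ?_
        · split_ifs <;> [skip; positivity]
          have : (0 : ℝ) ≤ (Nat.card K : ℝ) - 1 := sub_nonneg.2 hone
          positivity
        · have : (0 : ℝ) ≤ (Nat.card K : ℝ) - 1 := sub_nonneg.2 hone
          split_ifs
          · exact le_rfl
          · exact le_add_of_nonneg_right (by positivity)

/-- The average over random maps `f` of a product over the fibres of `f`. -/
theorem sum_prod_one_add_le {V : Type*} [Fintype V] [Nonempty V] (n : ℕ) {b : ℝ} (hb : 0 ≤ b) :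
    ∑ f : Fin n → V, ∏ v : V, (1 + b * (1 / 2 : ℝ) ^ Nat.card {i // f i = v}) ≤
      (Fintype.card V : ℝ) ^ n +
        ((Fintype.card V : ℝ) - 1 / 2) ^ n * (1 + b) ^ Fintype.card V := by
  classical
  have hM : (1 : ℝ) ≤ Fintype.card V := by exact_mod_cast Fintype.card_pos
  have hnat (f : Fin n → V) (v : V) :
      Nat.card {i // f i = v} = Fintype.card {i // f i = v} := Nat.card_eq_fintype_card
  simp only [hnat]
  -- The total size of the fibres over `S` counts the `i` with `f i ∈ S`, so the powers of `1/2`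
  -- become a product over `i`.
  have hprod (f : Fin n → V) (S : Finset V) :
      ∏ v ∈ S, (b * (1 / 2 : ℝ) ^ Fintype.card {i // f i = v}) =
        b ^ S.card * ∏ i, if f i ∈ S then (1 / 2 : ℝ) else 1 := by
    rw [Finset.prod_mul_distrib, Finset.prod_const]
    congr 1
    have (v : V) : (1 / 2 : ℝ) ^ Fintype.card {i // f i = v} =
        ∏ i, if f i = v then (1 / 2 : ℝ) else 1 := by
      rw [Fintype.card_subtype, ← Finset.prod_const, Finset.prod_filter]
    rw [Finset.prod_congr rfl fun v _ => this v, Finset.prod_comm]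
    exact Finset.prod_congr rfl fun i _ => Finset.prod_ite_eq S (f i) _
  -- The values `f i` vary independently, so the sum over `f` is an `n`-th power.
  have hsum (S : Finset V) : ∑ f : Fin n → V, ∏ i, (if f i ∈ S then (1 / 2 : ℝ) else 1) =
      ((Fintype.card V : ℝ) - S.card / 2) ^ n := by
    rw [← Fintype.sum_pow fun v => if v ∈ S then (1 / 2 : ℝ) else 1]
    congr 1
    have (v : V) : (if v ∈ S then (1 / 2 : ℝ) else 1) = 1 - if v ∈ S then (1 / 2 : ℝ) else 0 := by
      split_ifs <;> norm_num
    rw [Finset.sum_congr rfl fun v _ => this v, Finset.sum_sub_distrib, Finset.sum_ite_mem,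
      Finset.univ_inter, Finset.sum_const, Finset.sum_const, Finset.card_univ, nsmul_eq_mul,
      nsmul_eq_mul]
    ring
  have hpow : ∑ S : Finset V, b ^ S.card = (1 + b) ^ Fintype.card V := by
    have := Finset.prod_one_add (s := (Finset.univ : Finset V)) (f := fun _ => b)
    simpa using this.symm
  simp only [Finset.prod_one_add, hprod, Finset.powerset_univ]
  rw [Finset.sum_comm]
  simp only [← Finset.mul_sum, hsum]
  -- The empty set gives the main term; every nonempty `S` has base at most `|V| - 1/2`, and the
  -- remaining `b ^ |S|` sum to at most `(1 + b) ^ |V|`.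
  rw [← Finset.add_sum_erase _ _ (Finset.mem_univ (∅ : Finset V))]
  simp only [Finset.card_empty, pow_zero, Nat.cast_zero, zero_div, sub_zero, one_mul]
  gcongr
  rw [← hpow, Finset.mul_sum]
  refine (Finset.sum_le_sum (g := fun S : Finset V =>
    ((Fintype.card V : ℝ) - 1 / 2) ^ n * b ^ S.card) fun S hS => ?_).trans
    (Finset.sum_le_sum_of_subset_of_nonneg (Finset.subset_univ _) fun S _ _ => ?_)
  · rw [mul_comm]
    have h1 : (1 : ℝ) ≤ S.card := by
      exact_mod_cast Finset.card_pos.2 (Finset.nonempty_iff_ne_empty.2 (Finset.ne_of_mem_erase hS))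
    have h2 : (S.card : ℝ) ≤ Fintype.card V := by exact_mod_cast Finset.card_le_univ S
    gcongr
    linarith
  · have : (0 : ℝ) ≤ (Fintype.card V : ℝ) - 1 / 2 := by linarith
    positivity

/-! ### Random generators and the main probability bound -/

instance (G : Type*) [Group G] : DiscreteMeasurableSpace (UnitaryDual G) := ⟨fun _ => trivial⟩

section UniformTuples

variable {G : Type*} [Finite G] [Nonempty G] [MeasurableSpace G] [DiscreteMeasurableSpace G]

instance : IsProbabilityMeasure (uniformOn (Set.univ : Set G)) :=
  isProbabilityMeasure_uniformOn Set.finite_univ Set.univ_nonempty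

instance (t : ℕ) : IsProbabilityMeasure (uniformTuples G t) := by
  unfold uniformTuples
  infer_instance

omit [Nonempty G] in
theorem uniformTuples_real_singleton (t : ℕ) (h : Fin t → G) :
    (uniformTuples G t).real {h} = ((Nat.card G : ℝ) ^ t)⁻¹ := by
  have := Fintype.ofFinite G
  rw [measureReal_def, uniformTuples, Measure.pi_singleton, ENNReal.toReal_prod]
  simp [uniformOn_univ, Nat.card_eq_fintype_card]

/-- The product of a finite measure with the law of uniform tuples is an average. -/
theorem prod_uniformTuples_real {X : Type*} [Finite X] [MeasurableSpace X]
    [DiscreteMeasurableSpace X] (μ : Measure X) [IsFiniteMeasure μ] (t : ℕ)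
    [Fintype (Fin t → G)] (S : Set (X × (Fin t → G))) :
    (μ.prod (uniformTuples G t)).real S =
      (∑ h, μ.real {x | (x, h) ∈ S}) / (Nat.card G : ℝ) ^ t := by
  rw [measureReal_def, Measure.prod_apply_symm (.of_discrete), lintegral_fintype,
    ENNReal.toReal_sum fun h _ => ENNReal.mul_ne_top (measure_ne_top _ _) (measure_ne_top _ _),
    Finset.sum_div]
  refine Finset.sum_congr rfl fun h _ => ?_
  rw [ENNReal.toReal_mul, ← measureReal_def, ← measureReal_def, uniformTuples_real_singleton,
    div_eq_mul_inv]
  rfl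

end UniformTuples

section PowerGroup

variable {K : Type*} [Group K]

/-- The `i`-th entry of `h m` is the `m`-th coordinate of `f i`, so every generator is constant on
the fibres of `f` and the second moment bound for the larger group applies. -/
theorem plancherelMeasure_real_trivialFraction_eq_zero_le [Fintype K] (hZ : Subgroup.center K = ⊥)
    {n t : ℕ} (h : Fin t → Fin n → K) :
    (plancherelMeasure (Fin n → K)).real
        {ρ | trivialFraction (Subgroup.closure (Set.range h)) ρ = 0} ≤
      (∏ v : Fin t → K, (1 + 2 * ((Nat.card K : ℝ) - 1) *
        (1 / 2 : ℝ) ^ Nat.card {i // (fun m => h m i) = v})) - 1 := by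
  classical
  set f : Fin n → Fin t → K := fun i m => h m i with hf
  have hle : Subgroup.closure (Set.range h) ≤ (fibrewiseHom K f).range := by
    rw [Subgroup.closure_le]
    rintro _ ⟨m, rfl⟩
    exact ⟨fun v => v.1 m, rfl⟩
  have h1 : (plancherelMeasure (Fin n → K)).real
        {ρ | trivialFraction (Subgroup.closure (Set.range h)) ρ = 0} ≤
      (plancherelMeasure (Fin n → K)).real
        {ρ | ∑ φ, ρ.character (fibrewiseHom K f φ) = 0} :=
    measureReal_mono fun ρ hρ =>
      UnitaryDual.sum_character_eq_zero_of_trivialFraction_eq_zero _ hle ρ hρ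
  have h2 := UnitaryDual.plancherelMeasure_real_sum_character_eq_zero_le _
    (fibrewiseHom_injective K f)
  exact h1.trans (h2.trans (sub_le_sub_right (sum_conjWeight_fibrewiseHom_le hZ f) 1))

/-- The probability that no trivial component survives the restriction to a random subgroup. -/
theorem prob_trivialFraction_eq_zero_le [Finite K] [MeasurableSpace K]
    [DiscreteMeasurableSpace K] (hZ : Subgroup.center K = ⊥) (n t : ℕ) :
    ((plancherelMeasure (Fin n → K)).prod (uniformTuples (Fin n → K) t)).real
        {p | trivialFraction (Subgroup.closure (Set.range p.2)) p.1 = 0} ≤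
      (1 - 1 / (2 * (Nat.card K : ℝ) ^ t)) ^ n *
        (2 * (Nat.card K : ℝ) - 1) ^ (Nat.card K ^ t) := by
  classical
  have := Fintype.ofFinite K
  have hone : (1 : ℝ) ≤ Nat.card K := by exact_mod_cast Nat.card_pos
  have hM : (0 : ℝ) < (Nat.card K : ℝ) ^ t := by positivity
  have hcard : Fintype.card (Fin t → K) = Nat.card K ^ t := by simp
  rw [prod_uniformTuples_real, Nat.card_pi, Finset.prod_const, Finset.card_univ, Fintype.card_fin]
  push_cast
  rw [pow_right_comm, div_le_iff₀ (by positivity)]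
  have hb : (0 : ℝ) ≤ 2 * ((Nat.card K : ℝ) - 1) := by linarith
  have key := sum_prod_one_add_le (V := Fin t → K) n hb
  rw [hcard] at key
  push_cast at key
  calc _ ≤ ∑ h : Fin t → Fin n → K, ((∏ v : Fin t → K, (1 + 2 * ((Nat.card K : ℝ) - 1) *
        (1 / 2 : ℝ) ^ Nat.card {i // (fun m => h m i) = v})) - 1) :=
        Finset.sum_le_sum fun h _ => plancherelMeasure_real_trivialFraction_eq_zero_le hZ h
    _ = (∑ f : Fin n → Fin t → K, (∏ v : Fin t → K, (1 + 2 * ((Nat.card K : ℝ) - 1) *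
        (1 / 2 : ℝ) ^ Nat.card {i // f i = v}))) - ((Nat.card K : ℝ) ^ t) ^ n := by
        -- Transposition turns `t` random elements of `K^n` into a random map from `Fin n` to `K^t`.
        rw [← Equiv.sum_comp (Equiv.piComm fun (_ : Fin t) (_ : Fin n) => K),
          Finset.sum_sub_distrib, Finset.sum_const, Finset.card_univ, nsmul_eq_mul, mul_one]
        congr 1
        rw [Fintype.card_pi, Finset.prod_const, Fintype.card_pi, Finset.prod_const]
        simp only [Finset.card_univ, Fintype.card_fin, Nat.card_eq_fintype_card]
        push_cast
        exact pow_right_comm _ _ _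
    _ ≤ ((Nat.card K : ℝ) ^ t - 1 / 2) ^ n * (1 + 2 * ((Nat.card K : ℝ) - 1)) ^ (Nat.card K ^ t) :=
        sub_le_iff_le_add'.2 key
    _ = _ := by
        have h1 : (Nat.card K : ℝ) ^ t - 1 / 2 =
            (1 - 1 / (2 * (Nat.card K : ℝ) ^ t)) * (Nat.card K : ℝ) ^ t := by
          field_simp
        rw [h1, mul_pow]
        ring

end PowerGroup

/-- Markov's inequality for the sections of an event in a product. -/
theorem mul_measureReal_le_prod {X Y : Type*} [MeasurableSpace X] [MeasurableSpace Y]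
    (μ : Measure X) (ν : Measure Y) [IsFiniteMeasure μ] [IsFiniteMeasure ν] {S : Set (X × Y)}
    (hS : MeasurableSet S) {δ : ℝ} (hδ : 0 ≤ δ) :
    δ * μ.real {x | δ ≤ ν.real {y | (x, y) ∈ S}} ≤ (μ.prod ν).real S := by
  rw [measureReal_def (μ.prod ν), Measure.prod_apply hS]
  have h := mul_meas_ge_le_lintegral₀ (μ := μ) (measurable_measure_prodMk_left (ν := ν) hS).aemeasurable
    (ENNReal.ofReal δ)
  have hfin : ∫⁻ x, ν (Prod.mk x ⁻¹' S) ∂μ ≠ ⊤ := by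
    rw [← Measure.prod_apply hS]
    exact measure_ne_top _ _
  have hset : {x | ENNReal.ofReal δ ≤ ν (Prod.mk x ⁻¹' S)} =
      {x | δ ≤ ν.real {y | (x, y) ∈ S}} := by
    ext x
    exact ENNReal.ofReal_le_iff_le_toReal (measure_ne_top _ _)
  rw [hset] at h
  have h' := ENNReal.toReal_mono hfin h
  rwa [ENNReal.toReal_mul, ENNReal.toReal_ofReal hδ] at h'

/-! ### Numerical estimates -/

section Estimates

variable {k : ℝ}

/-- Uses `1 - x ≤ exp (-x)` and `2k - 1 ≤ k²`. -/
theorem one_sub_pow_mul_pow_le (hk : 1 ≤ k) (n : ℕ) {m : ℕ} (hm : 1 ≤ m) :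
    (1 - 1 / (2 * (m : ℝ))) ^ n * (2 * k - 1) ^ m ≤
      Real.exp (-(n / (2 * m)) + 2 * m * Real.log k) := by
  have hk0 : 0 < k := by linarith
  have hm' : (1 : ℝ) ≤ m := by exact_mod_cast hm
  rw [Real.exp_add]
  have h1 : (1 - 1 / (2 * (m : ℝ))) ^ n ≤ Real.exp (-(n / (2 * m))) := by
    have : -((n : ℝ) / (2 * m)) = n * (-(1 / (2 * m))) := by ring
    rw [this, Real.exp_nat_mul]
    refine pow_le_pow_left₀ ?_ (Real.one_sub_le_exp_neg _) _
    rw [sub_nonneg, div_le_one (by positivity)]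
    linarith
  have h2 : (2 * k - 1) ^ m ≤ Real.exp (2 * m * Real.log k) := by
    have : 2 * (m : ℝ) * Real.log k = m * Real.log (k ^ 2) := by
      rw [Real.log_pow]
      push_cast
      ring
    rw [this, Real.exp_nat_mul, Real.exp_log (by positivity)]
    exact pow_le_pow_left₀ (by linarith) (by nlinarith [sq_nonneg (k - 1)]) _
  exact mul_le_mul h1 h2 (pow_nonneg (by linarith) _) (Real.exp_pos _).le

/-- The hypothesis gives `n / (2m) ≥ √n / α`; passing from base `e` to base `2` only loses, since
`log 2 ≤ 1`. -/
theorem exp_le_rpow_sqrt (hk : 1 ≤ k) {n : ℕ} {m : ℝ} (hm : 0 < m) {α : ℝ}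
    (h : 2 * m ≤ α * √n) :
    Real.exp (-(n / (2 * m)) + 2 * m * Real.log k) ≤
      ((2 : ℝ) ^ (-1 / α) * k ^ α) ^ √(n : ℝ) := by
  have hk0 : 0 < k := by linarith
  have hs : 0 < √(n : ℝ) := by
    refine lt_of_le_of_ne (Real.sqrt_nonneg _) fun h0 => ?_
    rw [← h0, mul_zero] at h
    linarith
  have hα : 0 < α := pos_of_mul_pos_left (lt_of_lt_of_le (by linarith) h) hs.le
  rw [Real.rpow_def_of_pos two_pos, Real.rpow_def_of_pos hk0, ← Real.exp_add, ← Real.exp_mul]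
  refine Real.exp_le_exp.2 ?_
  have h1 : √(n : ℝ) / α ≤ n / (2 * m) := by
    rw [div_le_div_iff₀ hα (by linarith)]
    nlinarith [Real.mul_self_sqrt (Nat.cast_nonneg (α := ℝ) n)]
  have h2 : Real.log 2 * (√(n : ℝ) / α) ≤ √(n : ℝ) / α :=
    mul_le_of_le_one_left (by positivity) (by linarith [Real.log_two_lt_d9])
  have h3 : 2 * m * Real.log k ≤ α * √n * Real.log k :=
    mul_le_mul_of_nonneg_right h (Real.log_nonneg hk)
  have h4 : (Real.log 2 * (-1 / α) + Real.log k * α) * √(n : ℝ) =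
      -(Real.log 2 * (√(n : ℝ) / α)) + α * √n * Real.log k := by ring
  linarith

/-- Bases `1 < b ≤ e` are treated together because the natural logarithm of `k` is then at most
`logb b k`. With `s = √n` and `r = √(logb b k)`, the hypothesis `4mr ≤ s` makes the first term of
the exponent at most `-2sr` and the second at most `sr/2`; finally `exp x ≥ x`. -/
theorem exp_le_inv_sqrt (hk : 1 < k) {n : ℕ} {m : ℝ} (hm : 0 < m) {b : ℝ} (hb : 1 < b)
    (hb' : b ≤ Real.exp 1) (h : 4 * m * √(Real.logb b k) ≤ √(n : ℝ)) :
    Real.exp (-(n / (2 * m)) + 2 * m * Real.log k) ≤ (√(n * Real.logb b k))⁻¹ := by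
  set L := Real.logb b k with hLdef
  have hL : 0 < L := Real.logb_pos hb hk
  have hlogb : Real.log b ≤ 1 := (Real.log_le_iff_le_exp (by linarith)).2 hb'
  have hlogk : Real.log k ≤ L := by
    have h1 : Real.log k = L * Real.log b := by
      rw [hLdef, ← Real.log_div_log, div_mul_cancel₀ _ (Real.log_pos hb).ne']
    rw [h1]
    exact mul_le_of_le_one_right hL.le hlogb
  have hr : 0 < √L := Real.sqrt_pos.2 hL
  have hs : 0 < √(n : ℝ) := lt_of_lt_of_le (by positivity) h
  rw [Real.sqrt_mul (Nat.cast_nonneg n)]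
  set s := √(n : ℝ) with hsdef
  set r := √L with hrdef
  have hss : s * s = n := Real.mul_self_sqrt (Nat.cast_nonneg n)
  have hrr : r * r = L := Real.mul_self_sqrt hL.le
  have h1 : 2 * (s * r) ≤ n / (2 * m) := by
    rw [le_div_iff₀ (by linarith), ← hss]
    nlinarith
  have h2 : 2 * m * Real.log k ≤ s * r / 2 := by
    have : 2 * m * Real.log k ≤ 2 * m * (r * r) := by
      rw [hrr]
      exact mul_le_mul_of_nonneg_left hlogk (by linarith)
    nlinarith
  have hsr : 0 < s * r := mul_pos hs hr
  calc _ ≤ Real.exp (-(s * r)) := Real.exp_le_exp.2 (by linarith)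
    _ ≤ _ := by
      rw [Real.exp_neg]
      exact inv_anti₀ hsr (by linarith [Real.add_one_le_exp (s * r)])

end Estimates

/-! ### Markov's inequality and statements for most representations -/

section PowerGroup

variable {K : Type*} [Group K] [Finite K] [MeasurableSpace K] [DiscreteMeasurableSpace K]

theorem prob_trivialFraction_eq_zero_le_exp (hZ : Subgroup.center K = ⊥) (n t : ℕ) :
    ((plancherelMeasure (Fin n → K)).prod (uniformTuples (Fin n → K) t)).real
        {p | trivialFraction (Subgroup.closure (Set.range p.2)) p.1 = 0} ≤
      Real.exp (-(n / (2 * (Nat.card K : ℝ) ^ t)) +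
        2 * (Nat.card K : ℝ) ^ t * Real.log (Nat.card K)) := by
  have hone : (1 : ℝ) ≤ Nat.card K := by exact_mod_cast Nat.card_pos
  have h := one_sub_pow_mul_pow_le hone n (m := Nat.card K ^ t)
    (Nat.one_le_pow _ _ Nat.card_pos)
  push_cast at h
  exact (prob_trivialFraction_eq_zero_le hZ n t).trans h

/-- For most `ρ`, a random subgroup acts without invariant vectors only rarely. -/
theorem mul_plancherelMeasure_real_le (hK : 1 < Nat.card K) (hZ : Subgroup.center K = ⊥)
    (n t : ℕ) {b : ℝ} (hb : 1 < b) (hb' : b ≤ Real.exp 1)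
    (h : 4 * (Nat.card K : ℝ) ^ t * √(Real.logb b (Nat.card K)) ≤ √(n : ℝ)) {δ : ℝ} (hδ : 0 ≤ δ) :
    δ * (plancherelMeasure (Fin n → K)).real
        {ρ | δ ≤ (uniformTuples (Fin n → K) t).real
          {h | trivialFraction (Subgroup.closure (Set.range h)) ρ = 0}} ≤
      (√(n * Real.logb b (Nat.card K)))⁻¹ := by
  have hk : (1 : ℝ) < Nat.card K := by exact_mod_cast hK
  have hmarkov := mul_measureReal_le_prod (plancherelMeasure (Fin n → K))
    (uniformTuples (Fin n → K) t)
    (S := {p | trivialFraction (Subgroup.closure (Set.range p.2)) p.1 = 0}) .of_discrete hδ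
  simp only [Set.mem_ofPred_eq] at hmarkov
  refine hmarkov.trans ((prob_trivialFraction_eq_zero_le_exp hZ n t).trans ?_)
  exact exp_le_inv_sqrt hk (by positivity) hb hb' h

theorem one_sub_le_uniformTuples_real_averageNorm {G : Type*} [Group G] [Finite G]
    [MeasurableSpace G] [DiscreteMeasurableSpace G] {t : ℕ} (ht : 1 ≤ t) (ρ : UnitaryDual G) :
    1 - (uniformTuples G t).real {h | trivialFraction (Subgroup.closure (Set.range h)) ρ = 0} ≤
      (uniformTuples G t).real {h | averageNorm ρ h = 1} := by
  rw [← probReal_compl_eq_one_sub .of_discrete]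
  exact measureReal_mono fun h hh =>
    UnitaryDual.averageNorm_eq_one_of_trivialFraction_ne_zero ht ρ h hh

theorem uniformTuples_real_averageNorm_le_integral {G : Type*} [Group G] [Finite G]
    [MeasurableSpace G] [DiscreteMeasurableSpace G] {t : ℕ} (ρ : UnitaryDual G) :
    (uniformTuples G t).real {h | averageNorm ρ h = 1} ≤
      ∫ h, averageNorm ρ h ∂(uniformTuples G t) := by
  rw [← integral_indicator_one (.of_discrete)]
  refine integral_mono .of_finite .of_finite fun h => ?_
  by_cases hh : averageNorm ρ h = 1
  · rw [Set.indicator_of_mem (by exact hh), hh]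
    rfl
  · rw [Set.indicator_of_notMem (by exact hh)]
    exact norm_nonneg _

-- The constant tuple of some `k ≠ 1` has a conjugacy class of size at least `2^n`.
omit [MeasurableSpace K] [DiscreteMeasurableSpace K] in
theorem plancherelMeasure_real_forall_rep_eq_one_le_pow (hK : 1 < Nat.card K)
    (hZ : Subgroup.center K = ⊥) (n : ℕ) :
    (plancherelMeasure (Fin n → K)).real {ρ | ∀ g, ρ.out.rep g = 1} ≤ (1 / 2 : ℝ) ^ n := by
  have : Nontrivial K := Finite.one_lt_card_iff_nontrivial.1 hK
  obtain ⟨k, hk⟩ := exists_ne (1 : K)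
  refine (UnitaryDual.plancherelMeasure_real_forall_rep_eq_one_le fun _ => k).trans ?_
  rw [← conjWeight_self, conjWeight_pi, Finset.prod_const, Finset.card_univ, Fintype.card_fin,
    conjWeight_self, one_div]
  have h2 : (2 : ℝ) ≤ Nat.card (conjugatesOf k) := by
    exact_mod_cast two_le_natCard_conjugatesOf hZ hk
  exact pow_le_pow_left₀ (by positivity) (inv_anti₀ two_pos h2) n

theorem one_sub_sqrt_two_div_le_plancherelMeasure_real (hK : 1 < Nat.card K)
    (hZ : Subgroup.center K = ⊥) (n t : ℕ) {b : ℝ} (hb : 1 < b) (hb' : b ≤ Real.exp 1)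
    (ht : 1 ≤ t)
    (h : 4 * (Nat.card K : ℝ) ^ t * √(Real.logb b (Nat.card K)) ≤ √(n : ℝ)) :
    1 - √2 / (n * Real.logb b (Nat.card K)) ^ (1 / 4 : ℝ) ≤
      (plancherelMeasure (Fin n → K)).real
        {ρ | 1 - √2 / (n * Real.logb b (Nat.card K)) ^ (1 / 4 : ℝ) ≤
          (uniformTuples (Fin n → K) t).real {h | averageNorm ρ h = 1}} := by
  have hk : (1 : ℝ) < Nat.card K := by exact_mod_cast hK
  have hL : 0 < Real.logb b (Nat.card K) := Real.logb_pos hb hk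
  have hn : (0 : ℝ) < n := by
    rw [← Real.sqrt_pos]
    exact lt_of_lt_of_le (by positivity) h
  have hx : (0 : ℝ) < n * Real.logb b (Nat.card K) := mul_pos hn hL
  set x := n * Real.logb b (Nat.card K) with hxdef
  set δ := √2 / x ^ (1 / 4 : ℝ) with hδdef
  have hδ : 0 < δ := by positivity
  -- The same `δ` serves as Markov threshold and as failure probability, which explains the fourth
  -- root: it suffices that `δ²` be at least `1/√x`.
  have hδ2 : δ * δ = 2 * (√x)⁻¹ := by
    rw [hδdef, div_mul_div_comm, Real.mul_self_sqrt zero_le_two, ← Real.rpow_add hx,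
      Real.sqrt_eq_rpow, div_eq_mul_inv]
    norm_num
  set B := {ρ | δ ≤ (uniformTuples (Fin n → K) t).real
    {h | trivialFraction (Subgroup.closure (Set.range h)) ρ = 0}} with hB
  have hmarkov := mul_plancherelMeasure_real_le hK hZ n t hb hb' h hδ.le
  rw [← hxdef, ← hB] at hmarkov
  have hBle : (plancherelMeasure (Fin n → K)).real B ≤ δ := by
    refine le_of_mul_le_mul_left (hmarkov.trans ?_) hδ
    rw [hδ2]
    have : 0 ≤ (√x)⁻¹ := by positivity
    linarith
  calc 1 - δ ≤ (plancherelMeasure (Fin n → K)).real Bᶜ := by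
        rw [probReal_compl_eq_one_sub .of_discrete]
        linarith
    _ ≤ _ := by
        refine measureReal_mono fun ρ hρ => ?_
        have hρ' := not_le.1 (show ¬ δ ≤ _ from hρ)
        exact le_trans (by linarith) (one_sub_le_uniformTuples_real_averageNorm ht ρ)

/-- The failure probability in the lower bound on the number of random elements. -/
theorem plancherelMeasure_real_compl_le (hK : 1 < Nat.card K) (hZ : Subgroup.center K = ⊥)
    {n T : ℕ}
    (h : 4 * (Nat.card K : ℝ) ^ T * √(Real.log (Nat.card K)) ≤ √(n : ℝ)) {ε : ℝ} (hε : 0 < ε) :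
    1 - ((1 / 2 : ℝ) ^ n + T * ((√(n * Real.log (Nat.card K)))⁻¹ / ε)) ≤
      (plancherelMeasure (Fin n → K)).real
        {ρ | (∃ g, ρ.out.rep g ≠ 1) ∧ ∀ t : ℕ, 1 ≤ t → t ≤ T →
          1 - ε < ∫ h, averageNorm ρ h ∂(uniformTuples (Fin n → K) t)} := by
  have hk : (1 : ℝ) < Nat.card K := by exact_mod_cast hK
  have hlogb : Real.logb (Real.exp 1) (Nat.card K) = Real.log (Nat.card K) := by
    simp [Real.logb]
  let B : ℕ → Set (UnitaryDual (Fin n → K)) := fun t =>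
    {ρ | ε ≤ (uniformTuples (Fin n → K) t).real
      {h | trivialFraction (Subgroup.closure (Set.range h)) ρ = 0}}
  let E : Set (UnitaryDual (Fin n → K)) := {ρ | ∀ g, ρ.out.rep g = 1}
  have hB (t : ℕ) (ht : t ∈ Finset.Icc 1 T) : (plancherelMeasure (Fin n → K)).real (B t) ≤
      (√(n * Real.log (Nat.card K)))⁻¹ / ε := by
    rw [le_div_iff₀ hε, mul_comm]
    have := mul_plancherelMeasure_real_le hK hZ n t (Real.one_lt_exp_iff.2 one_pos) le_rfl
      (by
        rw [hlogb]
        refine le_trans ?_ h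
        have := (Finset.mem_Icc.1 ht).2
        gcongr
        exact hk.le) hε.le
    rwa [hlogb] at this
  have hbad : (plancherelMeasure (Fin n → K)).real (E ∪ ⋃ t ∈ Finset.Icc 1 T, B t) ≤
      (1 / 2 : ℝ) ^ n + T * ((√(n * Real.log (Nat.card K)))⁻¹ / ε) := by
    refine (measureReal_union_le _ _).trans (add_le_add
      (plancherelMeasure_real_forall_rep_eq_one_le_pow hK hZ n)
      ((measureReal_biUnion_finset_le _ _).trans ((Finset.sum_le_sum hB).trans ?_)))
    simp
  calc _ ≤ (plancherelMeasure (Fin n → K)).real (E ∪ ⋃ t ∈ Finset.Icc 1 T, B t)ᶜ := by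
        rw [probReal_compl_eq_one_sub .of_discrete]
        linarith
    _ ≤ _ := by
        refine measureReal_mono fun ρ hρ => ?_
        rw [Set.compl_union] at hρ
        refine ⟨not_forall.1 hρ.1, fun t ht1 htT => ?_⟩
        have hρ' : ρ ∉ B t := fun hmem =>
          hρ.2 (Set.mem_biUnion (Finset.mem_coe.2 (Finset.mem_Icc.2 ⟨ht1, htT⟩)) hmem)
        have hlt := not_le.1 (show ¬ ε ≤ _ from hρ')
        refine lt_of_lt_of_le ?_ ((one_sub_le_uniformTuples_real_averageNorm ht1 ρ).trans
          (uniformTuples_real_averageNorm_le_integral ρ))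
        linarith

end PowerGroup

/-! ### Asymptotics and conclusion -/

theorem tendsto_half_pow_add_log_div_sqrt {L c ε : ℝ} (hL : 0 < L) :
    Tendsto (fun n : ℕ => (1 / 2 : ℝ) ^ n + c * Real.log (n * L) * ((√(n * L))⁻¹ / ε))
      atTop (nhds 0) := by
  have hx : Tendsto (fun n : ℕ => (n : ℝ) * L) atTop atTop :=
    tendsto_natCast_atTop_atTop.atTop_mul_const hL
  have h1 : Tendsto (fun x : ℝ => Real.log x / x ^ (1 / 2 : ℝ)) atTop (nhds 0) :=
    (isLittleO_log_rpow_atTop (by norm_num)).tendsto_div_nhds_zero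
  have h2 := ((h1.comp hx).const_mul (c / ε))
  have h3 := (tendsto_pow_atTop_nhds_zero_of_lt_one (r := (1 / 2 : ℝ)) (by norm_num)
    (by norm_num)).add h2
  rw [mul_zero, add_zero] at h3
  refine h3.congr fun n => ?_
  simp only [Function.comp, Real.sqrt_eq_rpow]
  ring

/-- With `L = log k`, the constant `1/(4L)` makes `k ^ T ≤ (nL)^(1/4)` for the floor `T`. After
multiplication by `√L` the claim is `4L * k ^ T ≤ √(nL)`, and the other factor `(nL)^(1/4)`
eventually exceeds `4L`. -/
theorem eventually_four_mul_pow_floor_mul_sqrt_log_le {k : ℝ} (hk : 1 < k) :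
    ∀ᶠ n : ℕ in atTop,
      4 * k ^ ⌊1 / (4 * Real.log k) * Real.log (n * Real.log k)⌋₊ * √(Real.log k) ≤
        √(n : ℝ) := by
  have hL : 0 < Real.log k := Real.log_pos hk
  set L := Real.log k with hLdef
  have hx : Tendsto (fun n : ℕ => (n : ℝ) * L) atTop atTop :=
    tendsto_natCast_atTop_atTop.atTop_mul_const hL
  have hq := (tendsto_rpow_atTop (y := (1 / 4 : ℝ)) (by norm_num)).comp hx
  filter_upwards [hx.eventually_ge_atTop 1, hq.eventually_ge_atTop (4 * L)] with n hn1 hn2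
  simp only [Function.comp] at hn2
  have hx0 : 0 < (n : ℝ) * L := by linarith
  have hfloor : (⌊1 / (4 * L) * Real.log (n * L)⌋₊ : ℝ) ≤ 1 / (4 * L) * Real.log (n * L) :=
    Nat.floor_le (mul_nonneg (by positivity) (Real.log_nonneg hn1))
  have hpow : k ^ ⌊1 / (4 * L) * Real.log (n * L)⌋₊ ≤ (n * L) ^ (1 / 4 : ℝ) := by
    rw [← Real.rpow_natCast, Real.rpow_def_of_pos (by linarith), Real.rpow_def_of_pos hx0,
      ← hLdef]
    refine Real.exp_le_exp.2 ((mul_le_mul_of_nonneg_left hfloor hL.le).trans (le_of_eq ?_))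
    field_simp
  refine le_of_mul_le_mul_right ?_ (Real.sqrt_pos.2 hL)
  rw [← Real.sqrt_mul (Nat.cast_nonneg n), mul_assoc, Real.mul_self_sqrt hL.le]
  have hsq : √((n : ℝ) * L) = (n * L) ^ (1 / 4 : ℝ) * (n * L) ^ (1 / 4 : ℝ) := by
    rw [← Real.rpow_add hx0, Real.sqrt_eq_rpow]
    norm_num
  rw [hsq]
  calc _ = (4 * L) * k ^ ⌊1 / (4 * L) * Real.log (n * L)⌋₊ := by ring
    _ ≤ _ := by gcongr

theorem theorem2 (K : Type*) [Group K] [Finite K]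
    [MeasurableSpace K] [DiscreteMeasurableSpace K]
    (hK : ∃ a b : K, a * b ≠ b * a) (hZ : Subgroup.center K = ⊥) :
    -- the bound on the probability that no trivial component survives the restriction
    (∀ (n t : ℕ) (α : ℝ), 2 * (Nat.card K : ℝ) ^ t ≤ α * √(n : ℝ) →
      ((plancherelMeasure (Fin n → K)).prod (uniformTuples (Fin n → K) t)).real
          {p | trivialFraction (Subgroup.closure (Set.range p.2)) p.1 = 0}
        ≤ 2 * α / √(n : ℝ)
          + ((2 : ℝ) ^ (-1 / α) * (Nat.card K : ℝ) ^ α) ^ √(n : ℝ)) ∧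
    -- the consequence for operator norms, for logarithms to base `2` and to base `e`
    (∀ (n t : ℕ) (b : ℝ), (b = 2 ∨ b = Real.exp 1) → 1 ≤ t →
      4 * (Nat.card K : ℝ) ^ t * √(Real.logb b (Nat.card K)) ≤ √(n : ℝ) →
      1 - √2 / (n * Real.logb b (Nat.card K)) ^ (1 / 4 : ℝ) ≤
        (plancherelMeasure (Fin n → K)).real
          {ρ | 1 - √2 / (n * Real.logb b (Nat.card K)) ^ (1 / 4 : ℝ) ≤
            (uniformTuples (Fin n → K) t).real {h | averageNorm ρ h = 1}}) ∧
    -- the lower bound of order `log log |G|` on the number of random elements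
    (∃ c : ℝ, 0 < c ∧ ∀ ε : ℝ, 0 < ε → ∀ᶠ n : ℕ in atTop,
      1 - ε ≤ (plancherelMeasure (Fin n → K)).real
        {ρ | (∃ g, ρ.out.rep g ≠ 1) ∧
          ∀ t : ℕ, 1 ≤ t → (t : ℝ) ≤ c * Real.log (Real.log (Nat.card (Fin n → K))) →
            1 - ε < ∫ h, averageNorm ρ h ∂(uniformTuples (Fin n → K) t)}) := by
  have hK1 : 1 < Nat.card K := by
    obtain ⟨a, b, hab⟩ := hK
    exact Finite.one_lt_card_iff_nontrivial.2 ⟨a, b, fun h => hab (by rw [h])⟩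
  have hk : (1 : ℝ) < Nat.card K := by exact_mod_cast hK1
  have hL : 0 < Real.log (Nat.card K) := Real.log_pos hk
  refine ⟨fun n t α h => ?_, fun n t b hb ht h => ?_,
    1 / (4 * Real.log (Nat.card K)), by positivity, fun ε hε => ?_⟩
  · have hM : (0 : ℝ) < (Nat.card K : ℝ) ^ t := by positivity
    -- Only nonnegativity of this term matters; at `n = 0` the quotient is `0` by convention.
    have hα : 0 ≤ 2 * α / √(n : ℝ) := by
      rcases (Real.sqrt_nonneg (n : ℝ)).eq_or_lt with h0 | hs
      · rw [← h0, div_zero]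
      · have : 0 < α := pos_of_mul_pos_left (lt_of_lt_of_le (by positivity) h) hs.le
        positivity
    exact ((prob_trivialFraction_eq_zero_le_exp hZ n t).trans
      (exp_le_rpow_sqrt hk.le hM h)).trans (le_add_of_nonneg_left hα)
  · have hb1 : 1 < b ∧ b ≤ Real.exp 1 := by
      rcases hb with rfl | rfl
      · exact ⟨one_lt_two, by linarith [Real.add_one_le_exp (1 : ℝ)]⟩
      · exact ⟨Real.one_lt_exp_iff.2 one_pos, le_rfl⟩
    exact one_sub_sqrt_two_div_le_plancherelMeasure_real hK1 hZ n t hb1.1 hb1.2 ht h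
  · set L := Real.log (Nat.card K) with hLdef
    have hx : Tendsto (fun n : ℕ => (n : ℝ) * L) atTop atTop :=
      tendsto_natCast_atTop_atTop.atTop_mul_const hL
    -- Here `log |G| = n * L`, so the admissible `t` are those up to the floor of `log (n * L) / (4
    -- * L)`. A union bound over them costs a logarithm, against a failure probability of order `1 /
    -- √(n * L)` for each `t`.
    filter_upwards [eventually_four_mul_pow_floor_mul_sqrt_log_le hk,
      (tendsto_half_pow_add_log_div_sqrt (c := 1 / (4 * L)) (ε := ε) hL).eventually_le_const hε,
      hx.eventually_ge_atTop 1]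
      with n hn1 hn2 hn3
    have hlog : Real.log (Nat.card (Fin n → K)) = n * L := by
      rw [Nat.card_fun, Nat.card_eq_fintype_card (α := Fin n), Fintype.card_fin, Nat.cast_pow, Real.log_pow]
    rw [hlog]
    have hfloor : (⌊1 / (4 * L) * Real.log (n * L)⌋₊ : ℝ) ≤ 1 / (4 * L) * Real.log (n * L) :=
      Nat.floor_le (mul_nonneg (by positivity) (Real.log_nonneg hn3))
    refine le_trans ?_ ((plancherelMeasure_real_compl_le hK1 hZ hn1 hε).trans
      (measureReal_mono fun ρ hρ => ⟨hρ.1, fun t ht1 ht => hρ.2 t ht1 (Nat.le_floor ht)⟩))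
    have : (⌊1 / (4 * L) * Real.log (n * L)⌋₊ : ℝ) * ((√(n * L))⁻¹ / ε) ≤
        1 / (4 * L) * Real.log (n * L) * ((√(n * L))⁻¹ / ε) := by gcongr
    linarith
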